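/- A library consists of $n$ items $1,\dots,n$, and a cache holds $m$ of them, where $1\le m<n$. At each step one item is requested, independently of the past (independent reference model); item $i$ is requested with probability $p_i$, where $p_1\ge p_2\ge\dots\ge p_n>0$ and $\sum_{i=1}^n p_i=1$. The state of the cache is the vector $(x_1,\dots,x_m)$ of the $m$ pairwise distinct items it contains, listed by position. Under LRU, a requested item $i$ is put in the first position: if $i$ was in position $j$, the items in positions $1,\dots,j-1$ move back one position; if $i$ was not in the cache, all items move back one position and the item in the last position is evicted. Let $P$ be the transition matrix of the resulting Markov chain on the set $\mathcal S$ of all states. Then $P$ has a unique stationary distribution $\pi^*$. Its mixing time $$t_{\mathrm{mix}}^{\mathrm{LRU}}=\min\Big\{t\in\mathbb{Z}_{\ge 0}:\ \sup_{x\in\mathcal S}\|P^t(x,\cdot)-\pi^*\|_{TV}\le \tfrac12\Big\},\qquad \|\mu-\nu\|_{TV}=\tfrac12\sum_{y\in\mathcal S}|\mu(y)-\nu(y)|,$$ is finite and satisfies $$t_{\mathrm{mix}}^{\mathrm{LRU}}=O\left(\frac{n^{4m}\left(\prod_{j=1}^m p_j\right)^4\prod_{j=1}^{m-1}\left(1-\sum_{l=1}^{j}p_{n-l+1}\right)^2}{p_n^2\left(\prod_{j=1}^{m-1}\left(1-\sum_{l=1}^{j}p_{l}\right)\right)^4\prod_{j=n-m+1}^n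 p_j^2}\cdot\ln\left(\frac{\prod_{j=1}^{m-1}\left(1-\sum_{l=1}^{j}p_{n-l+1}\right)}{\prod_{j=n-m+1}^n p_j}\right)\right),$$ where the constant implied by $O(\cdot)$ is absolute: it depends neither on $n$ and $m$ nor on the probabilities $p_i$. -/

import Mathlib

open Finset Matrix

/-- The library: the items `1, …, n`. -/
abbrev Item (n : ℕ) : Type := {i : ℕ // i ∈ Finset.Icc 1 n}

/-- States of a cache of size `m` over the library `1, …, n`: vectors `(x₁, …, xₘ)` of `m` pairwise
distinct items, listed from the first position of the cache to the last one. -/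
abbrev CacheState (n m : ℕ) : Type := {x : List (Item n) // x.Nodup ∧ x.length = m}

instance cacheStateFinite (n m : ℕ) : Finite (CacheState n m) :=
  ((List.finite_length_eq (Item n) m).subset (fun _ hx => hx.2)).to_subtype

noncomputable instance cacheStateFintype (n m : ℕ) : Fintype (CacheState n m) :=
  Fintype.ofFinite _

/-- The LRU update of the cache content `x` when item `i` is requested. The item `i` goes to the first
position. On a hit the items that were in front of it move back one position; on a miss all items
move back one position and the one in the last position is evicted. -/
def lruList {n : ℕ} (m : ℕ) (i : Item n) (x : List (Item n)) : List (Item n) :=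
  (i :: x.erase i).take m

theorem lruList_nodup {n : ℕ} (m : ℕ) (i : Item n) (x : List (Item n)) (hx : x.Nodup) :
    (lruList m i x).Nodup := by
  refine List.Nodup.sublist (List.take_sublist _ _) (List.nodup_cons.2 ⟨?_, hx.erase i⟩)
  exact hx.not_mem_erase

theorem lruList_length {n : ℕ} (m : ℕ) (i : Item n) (x : List (Item n)) (hx : x.length = m) :
    (lruList m i x).length = m := by
  have h : x.length ≤ (x.erase i).length + 1 := by
    rw [List.length_erase]
    split_ifs <;> omega
  simp only [lruList, List.length_take, List.length_cons]
  omega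

/-- The LRU update as a map on cache states. -/
def lruRequest {n m : ℕ} (i : Item n) (x : CacheState n m) : CacheState n m :=
  ⟨lruList m i x.1, lruList_nodup m i x.1 x.2.1, lruList_length m i x.1 x.2.2⟩

/-- The transition matrix of LRU under the independent reference model: at each step, independently
of the past, item `i` is requested with probability `p i`. -/
noncomputable def lruMatrix (n m : ℕ) (p : ℕ → ℝ) :
    Matrix (CacheState n m) (CacheState n m) ℝ := by
  classical
  exact fun x y => ∑ i : Item n, if lruRequest i x = y then p i else 0

/-- `π` is a stationary probability distribution of the transition matrix `P`. -/
def IsStationaryDist {S : Type*} [Fintype S] (P : Matrix S S ℝ) (π : S → ℝ) : Prop :=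
  π ∈ stdSimplex ℝ S ∧ π ᵥ* P = π

/-- Total variation distance of two probability vectors on a finite set. -/
noncomputable def tvDist {S : Type*} [Fintype S] (μ ν : S → ℝ) : ℝ :=
  (1 / 2) * ∑ x, |μ x - ν x|

/-- `t` is the mixing time `t_mix(ε)` of the transition matrix `P` with stationary distribution `π`:
the smallest number `t` of steps such that, from every initial state `x`, the distribution after `t`
steps (row `x` of `P ^ t`) is within total variation distance `ε` of `π`. -/
def IsMixingTime {S : Type*} [Fintype S] [DecidableEq S] (P : Matrix S S ℝ) (π : S → ℝ) (ε : ℝ)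
    (t : ℕ) : Prop :=
  IsLeast {s : ℕ | ∀ x : S, tvDist ((P ^ s) x) π ≤ ε} t

/-- The bound on the mixing time of LRU. -/
noncomputable def lruMixingBound (n m : ℕ) (p : ℕ → ℝ) : ℝ :=
  ((n : ℝ) ^ (4 * m) * (∏ j ∈ Icc 1 m, p j) ^ 4
      * ∏ j ∈ Icc 1 (m - 1), (1 - ∑ l ∈ Icc 1 j, p (n - l + 1)) ^ 2)
    / (p n ^ 2 * (∏ j ∈ Icc 1 (m - 1), (1 - ∑ l ∈ Icc 1 j, p l)) ^ 4
      * ∏ j ∈ Icc (n - m + 1) n, p j ^ 2)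
  * Real.log ((∏ j ∈ Icc 1 (m - 1), (1 - ∑ l ∈ Icc 1 j, p (n - l + 1)))
      / ∏ j ∈ Icc (n - m + 1) n, p j)

/-! ### Total variation distance and mixtures. -/

section TotalVariation

variable {S : Type*} [Fintype S]

/-! Feed the same requests to two caches. If they agree on their first `k` positions, a request
inside this prefix keeps the agreement, and any other request extends it to `k + 1` positions. While
`k < m < n`, some item lies outside the prefix, so an extension has probability at least `p n`.
Induction on time gives distance at most `(m - k) * (1 - p n / m) ^ t` (`tvDist_lruMatrix_pow_le`).
Taking `k = 0` yields existence and uniqueness of the stationary law and mixing within about `2 * m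
^ 2 / p n` steps.

The stated bound is much weaker: it is at least `log 2 / p n ^ 4` (`log_two_div_le_lruMixingBound`),
while `m * p n ≤ n * p n ≤ 1` puts the mixing time below `3 / p n ^ 4`. -/

theorem tvDist_nonneg (μ ν : S → ℝ) : 0 ≤ tvDist μ ν := by
  unfold tvDist
  positivity

theorem tvDist_self (μ : S → ℝ) : tvDist μ μ = 0 := by
  simp [tvDist]

theorem tvDist_le_one {μ ν : S → ℝ} (hμ : μ ∈ stdSimplex ℝ S) (hν : ν ∈ stdSimplex ℝ S) :
    tvDist μ ν ≤ 1 := by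
  have h : ∑ x, |μ x - ν x| ≤ ∑ x, (μ x + ν x) := by
    refine Finset.sum_le_sum fun x _ => abs_le.2 ⟨?_, ?_⟩ <;> linarith [hμ.1 x, hν.1 x]
  rw [Finset.sum_add_distrib, hμ.2, hν.2] at h
  unfold tvDist
  linarith

/-- Total variation distance is convex under mixtures. -/
theorem tvDist_sum_le {ι : Type*} [Fintype ι] (w : ι → ℝ) (hw : ∀ i, 0 ≤ w i) (f g : ι → S → ℝ) :
    tvDist (fun y => ∑ i, w i * f i y) (fun y => ∑ i, w i * g i y)
      ≤ ∑ i, w i * tvDist (f i) (g i) := by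
  have h : ∑ y, |∑ i, w i * f i y - ∑ i, w i * g i y| ≤ ∑ y, ∑ i, w i * |f i y - g i y| := by
    refine Finset.sum_le_sum fun y _ => ?_
    rw [← Finset.sum_sub_distrib]
    refine (Finset.abs_sum_le_sum_abs _ _).trans (Finset.sum_le_sum fun i _ => ?_)
    rw [← mul_sub, abs_mul, abs_of_nonneg (hw i)]
  rw [Finset.sum_comm] at h
  unfold tvDist
  calc _ ≤ (1 / 2) * ∑ i, ∑ y, w i * |f i y - g i y| := by linarith
    _ = _ := by
      rw [Finset.mul_sum]
      refine Finset.sum_congr rfl fun i _ => ?_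
      rw [← Finset.mul_sum]
      ring

theorem tvDist_sum_le_of_forall_le {ι : Type*} [Fintype ι] {w : ι → ℝ} (hw : w ∈ stdSimplex ℝ ι)
    (f : ι → S → ℝ) (μ : S → ℝ) {c : ℝ} (hc : ∀ i, tvDist (f i) μ ≤ c) :
    tvDist (fun y => ∑ i, w i * f i y) μ ≤ c := by
  have h := tvDist_sum_le w hw.1 f (fun _ => μ)
  simp only [← Finset.sum_mul, hw.2, one_mul] at h
  refine h.trans ?_
  calc _ ≤ ∑ i, w i * c := Finset.sum_le_sum fun i _ => mul_le_mul_of_nonneg_left (hc i) (hw.1 i)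
    _ = c := by rw [← Finset.sum_mul, hw.2, one_mul]

theorem tvDist_comm (μ ν : S → ℝ) : tvDist μ ν = tvDist ν μ := by
  simp only [tvDist, abs_sub_comm]

theorem dist_le_two_mul_tvDist (μ ν : S → ℝ) : dist μ ν ≤ 2 * tvDist μ ν := by
  refine (dist_pi_le_iff (mul_nonneg zero_le_two (tvDist_nonneg μ ν))).2 fun y => ?_
  have := Finset.single_le_sum (f := fun x => |μ x - ν x|) (fun x _ => abs_nonneg _)
    (Finset.mem_univ y)
  rw [Real.dist_eq]
  unfold tvDist
  linarith

end TotalVariation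

/-! ### Stationarity from geometric coalescence of rows. -/

section GeometricErgodicity

variable {S : Type*} [Fintype S] [DecidableEq S]

theorem IsStationaryDist.vecMul_pow {P : Matrix S S ℝ} {π : S → ℝ} (h : IsStationaryDist P π)
    (t : ℕ) : π ᵥ* P ^ t = π := by
  induction t with
  | zero => simp
  | succ t ih => rw [pow_succ, ← Matrix.vecMul_vecMul, ih, h.2]

/-- By stationarity `π` is itself a mixture of the rows of `P ^ t`, so convexity applies. -/
theorem IsStationaryDist.tvDist_pow_le {P : Matrix S S ℝ} {π : S → ℝ} (h : IsStationaryDist P π)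
    {t : ℕ} {c : ℝ} (hc : ∀ x z, tvDist ((P ^ t) x) ((P ^ t) z) ≤ c) (x : S) :
    tvDist ((P ^ t) x) π ≤ c := by
  rw [tvDist_comm]
  have h' : π = fun y => ∑ z, π z * (P ^ t) z y := (h.vecMul_pow t).symm
  rw [h']
  exact tvDist_sum_le_of_forall_le h.1 _ _ fun z => hc z x

/-- A stochastic matrix whose rows coalesce geometrically has exactly one stationary
distribution. -/
theorem existsUnique_isStationaryDist [Nonempty S] {P : Matrix S S ℝ}
    (hP : ∀ x, P x ∈ stdSimplex ℝ S) {c r : ℝ} (hr0 : 0 ≤ r) (hr : r < 1)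
    (h : ∀ t x z, tvDist ((P ^ t) x) ((P ^ t) z) ≤ c * r ^ t) :
    ∃ π, IsStationaryDist P π ∧ ∀ π', IsStationaryDist P π' → π' = π := by
  obtain ⟨x₀⟩ := ‹Nonempty S›
  have hrow : ∀ t x, (P ^ (t + 1)) x = (P ^ t) x ᵥ* P := fun t x => by
    rw [pow_succ]; rfl
  have hrow' : ∀ t x, (P ^ (t + 1)) x = fun y => ∑ z, P x z * (P ^ t) z y := fun t x => by
    rw [pow_succ']; rfl
  have hsimplex : ∀ t x, (P ^ t) x ∈ stdSimplex ℝ S := by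
    intro t
    induction t with
    | zero =>
      intro x
      simp only [pow_zero]
      refine ⟨fun y => ?_, by simp [Matrix.one_apply]⟩
      rw [Matrix.one_apply]
      split_ifs <;> norm_num
    | succ t ih =>
      intro x
      rw [hrow']
      refine ⟨fun y => Finset.sum_nonneg fun z _ => mul_nonneg ((hP x).1 z) ((ih z).1 y), ?_⟩
      rw [Finset.sum_comm]
      simp only [← Finset.mul_sum, (ih _).2, mul_one, (hP x).2]
  -- Row `x₀` at time `t + 1` is a mixture of the rows at time `t`, all within `c * r ^ t` of row
  -- `x₀`.
  have hcauchy : CauchySeq fun t => (P ^ t) x₀ := by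
    refine cauchySeq_of_le_geometric r (2 * c) hr fun t => ?_
    refine (dist_le_two_mul_tvDist _ _).trans ?_
    rw [tvDist_comm, hrow', mul_assoc]
    exact mul_le_mul_of_nonneg_left
      (tvDist_sum_le_of_forall_le (hP x₀) _ _ fun z => h t z x₀) zero_le_two
  obtain ⟨π, hπ⟩ := cauchySeq_tendsto_of_complete hcauchy
  have hst : IsStationaryDist P π := by
    refine ⟨(isClosed_stdSimplex ℝ S).mem_of_tendsto hπ
      (Filter.Eventually.of_forall fun t => hsimplex t x₀), ?_⟩
    have hcont : Continuous fun v : S → ℝ => v ᵥ* P :=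
      continuous_id.matrix_vecMul continuous_const
    have h1 := (hcont.tendsto π).comp hπ
    have h2 := hπ.comp (Filter.tendsto_add_atTop_nat 1)
    refine tendsto_nhds_unique h1 (h2.congr fun t => ?_)
    exact hrow t x₀
  refine ⟨π, hst, fun π' hst' => ?_⟩
  have hlim : Filter.Tendsto (fun t : ℕ => 2 * (c * r ^ t)) Filter.atTop (nhds 0) := by
    simpa using ((tendsto_pow_atTop_nhds_zero_of_lt_one hr0 hr).const_mul c).const_mul 2
  refine dist_le_zero.1 (ge_of_tendsto' hlim fun t => (dist_le_two_mul_tvDist _ _).trans ?_)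
  refine mul_le_mul_of_nonneg_left ?_ zero_le_two
  have h' : π' = fun y => ∑ z, π' z * (P ^ t) z y := (hst'.vecMul_pow t).symm
  rw [h']
  exact tvDist_sum_le_of_forall_le hst'.1 _ _ fun z => hst.tvDist_pow_le (h t) z

end GeometricErgodicity

/-! ### Coupling of two LRU caches through common requests. -/

section LRU

theorem sum_item {n : ℕ} (p : ℕ → ℝ) : ∑ i : Item n, p i = ∑ i ∈ Finset.Icc 1 n, p i :=
  Finset.sum_coe_sort (Finset.Icc 1 n) p

theorem sum_lruMatrix_mul {n m : ℕ} (p : ℕ → ℝ) (x : CacheState n m) (f : CacheState n m → ℝ) :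
    ∑ y, lruMatrix n m p x y * f y = ∑ i : Item n, p i * f (lruRequest i x) := by
  classical
  simp only [lruMatrix, Finset.sum_mul]
  rw [Finset.sum_comm]
  refine Finset.sum_congr rfl fun i _ => ?_
  rw [Finset.sum_eq_single (lruRequest i x)]
  · simp
  · intro y _ hy
    simp [hy.symm]
  · simp

theorem lruMatrix_mem_stdSimplex {n m : ℕ} {p : ℕ → ℝ} (hp : ∀ i ∈ Finset.Icc 1 n, 0 < p i)
    (hsum : ∑ i ∈ Finset.Icc 1 n, p i = 1) (x : CacheState n m) :
    lruMatrix n m p x ∈ stdSimplex ℝ (CacheState n m) := by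
  constructor
  · intro y
    simp only [lruMatrix]
    refine Finset.sum_nonneg fun i _ => ?_
    split_ifs
    exacts [(hp i i.2).le, le_rfl]
  · have h := sum_lruMatrix_mul p x fun _ => 1
    simp only [mul_one, sum_item, hsum] at h
    exact h

/-- A request for an item in a common prefix of two cache states preserves the common prefix. -/
theorem lruList_take_eq_of_mem {n m k : ℕ} {i : Item n} {x z : List (Item n)} (hk : k ≤ m)
    (hxl : x.length = m) (hzl : z.length = m) (h : x.take k = z.take k) (hi : i ∈ x.take k) :
    (lruList m i x).take k = (lruList m i z).take k := by
  have key : ∀ y : List (Item n), y.length = m → i ∈ y.take k →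
      (lruList m i y).take k = i :: (y.take k).erase i := by
    intro y hy hiy
    have hlen : (i :: (y.take k).erase i).length = k := by
      have := List.length_pos_of_mem hiy
      rw [List.length_cons, List.length_erase_of_mem hiy]
      rw [List.length_take] at *
      omega
    conv_lhs => rw [← List.take_append_drop k y]
    rw [lruList, List.take_take, min_eq_left hk, List.erase_append_left _ hiy, ← List.cons_append]
    exact List.take_left' hlen
  rw [key x hxl hi, key z hzl (h ▸ hi), h]

/-- A request for an item outside a common prefix of two cache states extends the common
prefix. -/
theorem lruList_take_succ_eq_of_notMem {n m k : ℕ} {i : Item n} {x z : List (Item n)} (hk : k < m)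
    (hxl : x.length = m) (hzl : z.length = m) (h : x.take k = z.take k) (hi : i ∉ x.take k) :
    (lruList m i x).take (k + 1) = (lruList m i z).take (k + 1) := by
  have key : ∀ y : List (Item n), y.length = m → i ∉ y.take k →
      (lruList m i y).take (k + 1) = i :: y.take k := by
    intro y hy hiy
    have hlen : (i :: y.take k).length = k + 1 := by
      rw [List.length_cons, List.length_take]
      omega
    conv_lhs => rw [← List.take_append_drop k y]
    rw [lruList, List.take_take, min_eq_left (by omega), List.erase_append_right _ hiy,
      ← List.cons_append]
    exact List.take_left' hlen
  rw [key x hxl hi, key z hzl (h ▸ hi), h]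

theorem le_sum_notMem {n : ℕ} {p : ℕ → ℝ} (hp : ∀ i ∈ Finset.Icc 1 n, 0 < p i)
    (hanti : AntitoneOn p (Set.Icc 1 n)) {a : List (Item n)} (ha : a.length < n) :
    p n ≤ ∑ i : Item n, if i ∈ a then 0 else p i := by
  obtain ⟨i, hi⟩ : ∃ i : Item n, i ∉ a := by
    by_contra! hall
    have h1 : (Finset.univ : Finset (Item n)) ⊆ a.toFinset := fun i _ => by simpa using hall i
    have h2 := (Finset.card_le_card h1).trans a.toFinset_card_le
    simp at h2
    omega
  have hmem := Finset.mem_Icc.1 i.2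
  calc p n ≤ p i := hanti ⟨hmem.1, hmem.2⟩ ⟨by omega, le_rfl⟩ hmem.2
    _ = if i ∈ a then 0 else p i := by simp [hi]
    _ ≤ _ := Finset.single_le_sum (f := fun i : Item n => if i ∈ a then 0 else p i)
      (fun j _ => by
        split_ifs
        exacts [le_rfl, (hp j j.2).le]) (Finset.mem_univ i)

/-- The factor `m - k` counts the positions not yet known to agree; in expectation it shrinks by at
least the ratio `1 - p n / m` per step. -/
theorem tvDist_lruMatrix_pow_le {n m : ℕ} {p : ℕ → ℝ} (hm : 1 ≤ m) (hmn : m < n)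
    (hp : ∀ i ∈ Finset.Icc 1 n, 0 < p i) (hanti : AntitoneOn p (Set.Icc 1 n))
    (hsum : ∑ i ∈ Finset.Icc 1 n, p i = 1) (hpn : p n ≤ 1) (t : ℕ) :
    ∀ (k : ℕ), k ≤ m → ∀ x z : CacheState n m, x.1.take k = z.1.take k →
      tvDist ((lruMatrix n m p ^ t) x) ((lruMatrix n m p ^ t) z)
        ≤ ((m : ℝ) - k) * (1 - p n / m) ^ t := by
  have hm0 : (1 : ℝ) ≤ m := by exact_mod_cast hm
  have hr0 : 0 ≤ 1 - p n / m := by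
    rw [sub_nonneg, div_le_one (by linarith)]
    linarith
  have heq : ∀ t (x z : CacheState n m), x.1.take m = z.1.take m →
      tvDist ((lruMatrix n m p ^ t) x) ((lruMatrix n m p ^ t) z) ≤ 0 := by
    intro t x z h
    rw [List.take_of_length_le x.2.2.le, List.take_of_length_le z.2.2.le] at h
    rw [Subtype.ext h, tvDist_self]
  induction t with
  | zero =>
    intro k hk x z h
    rcases hk.eq_or_lt with rfl | hk
    · simpa using heq 0 x z h
    · have hone : ∀ x : CacheState n m,
          (1 : Matrix (CacheState n m) (CacheState n m) ℝ) x ∈ stdSimplex ℝ _ := fun x => by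
        refine ⟨fun y => ?_, by simp [Matrix.one_apply]⟩
        rw [Matrix.one_apply]
        split_ifs <;> norm_num
      have h1 : (k : ℝ) + 1 ≤ m := by exact_mod_cast hk
      have h2 := tvDist_le_one (hone x) (hone z)
      simp only [pow_zero, mul_one]
      linarith
  | succ t ih =>
    intro k hk x z h
    rcases hk.eq_or_lt with rfl | hk
    · simpa using heq (t + 1) x z h
    have hrow : ∀ x : CacheState n m, (lruMatrix n m p ^ (t + 1)) x
        = fun y => ∑ i : Item n, p i * (lruMatrix n m p ^ t) (lruRequest i x) y := fun x => by
      rw [pow_succ']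
      funext y
      exact sum_lruMatrix_mul p x fun w => (lruMatrix n m p ^ t) w y
    rw [hrow, hrow]
    refine (tvDist_sum_le (fun i : Item n => p i) (fun i => (hp i i.2).le) _ _).trans ?_
    have hrt : 0 ≤ (1 - p n / m) ^ t := pow_nonneg hr0 t
    -- A request inside the prefix leaves the weight `m - k` unchanged; one outside lowers it by
    -- one.
    have hterm : ∀ i : Item n,
        p i * tvDist ((lruMatrix n m p ^ t) (lruRequest i x))
          ((lruMatrix n m p ^ t) (lruRequest i z))
        ≤ (p i * (m - k) - if i ∈ x.1.take k then 0 else p i) * (1 - p n / m) ^ t := by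
      intro i
      have hpi := (hp i i.2).le
      split_ifs with hi
      · have := ih k hk.le (lruRequest i x) (lruRequest i z)
          (lruList_take_eq_of_mem hk.le x.2.2 z.2.2 h hi)
        nlinarith [mul_le_mul_of_nonneg_left this hpi]
      · have := ih (k + 1) hk (lruRequest i x) (lruRequest i z)
          (lruList_take_succ_eq_of_notMem hk x.2.2 z.2.2 h hi)
        push_cast at this
        nlinarith [mul_le_mul_of_nonneg_left this hpi]
    refine (Finset.sum_le_sum fun i _ => hterm i).trans ?_
    rw [← Finset.sum_mul, Finset.sum_sub_distrib, ← Finset.sum_mul, sum_item, hsum, pow_succ']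
    have hmiss : p n ≤ ∑ i : Item n, if i ∈ x.1.take k then 0 else p i :=
      le_sum_notMem hp hanti (by rw [List.length_take]; omega)
    have hk0 : (0 : ℝ) ≤ k := k.cast_nonneg
    -- Since `m - k ≤ m`, the additive gain `p n` is at least the fraction `p n / m` of the current
    -- weight.
    have hdiv : ((m : ℝ) - k) * (p n / m) ≤ p n := by
      have hpn0 : 0 ≤ p n := (hp n (Finset.mem_Icc.2 ⟨by omega, le_rfl⟩)).le
      rw [← mul_div_assoc, div_le_iff₀ (by linarith)]
      nlinarith
    rw [← mul_assoc]
    refine mul_le_mul_of_nonneg_right ?_ hrt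
    linarith

theorem nonempty_cacheState {n m : ℕ} (hmn : m < n) : Nonempty (CacheState n m) := by
  refine ⟨⟨(Finset.univ : Finset (Item n)).toList.take m,
    (Finset.nodup_toList _).sublist (List.take_sublist _ _), ?_⟩⟩
  simp
  omega

end LRU

/-! ### Lower bound for the stated expression. -/

section Bound

variable {n : ℕ} {p : ℕ → ℝ}

theorem one_sub_sum_smallest (hsum : ∑ i ∈ Finset.Icc 1 n, p i = 1) {j : ℕ} (hj : j ≤ n) :
    1 - ∑ l ∈ Finset.Icc 1 j, p (n - l + 1) = ∑ i ∈ Finset.Icc 1 (n - j), p i := by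
  induction j with
  | zero => simp [hsum]
  | succ j ih =>
    have h := ih (by omega)
    rw [Finset.sum_Icc_succ_top (by omega)]
    have e : n - j = (n - (j + 1)) + 1 := by omega
    rw [e, Finset.sum_Icc_succ_top (by omega)] at h
    linarith

theorem one_sub_sum_largest (hsum : ∑ i ∈ Finset.Icc 1 n, p i = 1) {j : ℕ} (hj : j ≤ n) :
    1 - ∑ l ∈ Finset.Icc 1 j, p l = ∑ i ∈ Finset.Icc (j + 1) n, p i := by
  induction j with
  | zero => simp [hsum]
  | succ j ih =>
    have h := ih (by omega)
    rw [Finset.sum_Icc_succ_top (by omega)]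
    rw [← Finset.add_sum_Ioc_eq_sum_Icc hj] at h
    have e : Finset.Ioc (j + 1) n = Finset.Icc (j + 1 + 1) n := by
      ext; simp
    rw [e] at h
    linarith

/-- The `j`-th factor on the right is the mass of the items `1, …, n - j`, which includes `p (n -
j)`. -/
theorem prod_smallest_le (hp : ∀ i ∈ Finset.Icc 1 n, 0 < p i)
    (hsum : ∑ i ∈ Finset.Icc 1 n, p i = 1) {k : ℕ} (hk : k < n) :
    ∏ j ∈ Finset.Icc (n - k) n, p j
      ≤ p n * ∏ j ∈ Finset.Icc 1 k, (1 - ∑ l ∈ Finset.Icc 1 j, p (n - l + 1)) := by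
  induction k with
  | zero => simp
  | succ k ih =>
    have h := ih (by omega)
    have hpos : 0 < p (n - (k + 1)) := hp _ (Finset.mem_Icc.2 ⟨by omega, by omega⟩)
    have hpr : 0 ≤ ∏ j ∈ Finset.Icc (n - k) n, p j := Finset.prod_nonneg fun j hj => by
      rw [Finset.mem_Icc] at hj
      exact (hp j (Finset.mem_Icc.2 ⟨by omega, hj.2⟩)).le
    rw [Finset.prod_Icc_succ_top (by omega), one_sub_sum_smallest hsum hk.le,
      ← Finset.mul_prod_Ioc_eq_prod_Icc (by omega), ← mul_assoc, mul_comm (p (n - (k + 1)))]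
    have e : Finset.Ioc (n - (k + 1)) n = Finset.Icc (n - k) n := by
      ext; simp; omega
    rw [e]
    have hle : p (n - (k + 1)) ≤ ∑ i ∈ Finset.Icc 1 (n - (k + 1)), p i :=
      Finset.single_le_sum (f := p) (fun i hi => by
        rw [Finset.mem_Icc] at hi
        exact (hp i (Finset.mem_Icc.2 ⟨hi.1, by omega⟩)).le) (Finset.mem_Icc.2 ⟨by omega, le_rfl⟩)
    exact mul_le_mul h hle hpos.le (hpr.trans h)

/-- The left side is a tail sum of at most `n` terms, the largest being `p (j + 1)`. -/
theorem one_sub_sum_largest_le (hp : ∀ i ∈ Finset.Icc 1 n, 0 < p i)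
    (hanti : AntitoneOn p (Set.Icc 1 n)) (hsum : ∑ i ∈ Finset.Icc 1 n, p i = 1) {j : ℕ}
    (hj : j < n) : 1 - ∑ l ∈ Finset.Icc 1 j, p l ≤ n * p (j + 1) := by
  rw [one_sub_sum_largest hsum hj.le]
  have h : ∀ i ∈ Finset.Icc (j + 1) n, p i ≤ p (j + 1) := fun i hi => by
    rw [Finset.mem_Icc] at hi
    exact hanti ⟨by omega, by omega⟩ ⟨by omega, hi.2⟩ hi.1
  refine (Finset.sum_le_card_nsmul _ _ _ h).trans ?_
  rw [nsmul_eq_mul]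
  refine mul_le_mul_of_nonneg_right ?_ (hp _ (Finset.mem_Icc.2 ⟨by omega, hj⟩)).le
  exact_mod_cast (by simp : (Finset.Icc (j + 1) n).card ≤ n)

theorem one_sub_sum_largest_pos (hp : ∀ i ∈ Finset.Icc 1 n, 0 < p i)
    (hsum : ∑ i ∈ Finset.Icc 1 n, p i = 1) {j : ℕ} (hj : j < n) :
    0 < 1 - ∑ l ∈ Finset.Icc 1 j, p l := by
  rw [one_sub_sum_largest hsum hj.le]
  refine Finset.sum_pos (fun i hi => ?_) ⟨n, Finset.mem_Icc.2 ⟨hj, le_rfl⟩⟩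
  rw [Finset.mem_Icc] at hi
  exact hp i (Finset.mem_Icc.2 ⟨by omega, hi.2⟩)

theorem prod_one_sub_sum_largest_le (hp : ∀ i ∈ Finset.Icc 1 n, 0 < p i)
    (hanti : AntitoneOn p (Set.Icc 1 n)) (hsum : ∑ i ∈ Finset.Icc 1 n, p i = 1) {k : ℕ}
    (hk : k < n) :
    ∏ j ∈ Finset.Icc 1 k, (1 - ∑ l ∈ Finset.Icc 1 j, p l)
      ≤ n ^ (k + 1) * ∏ j ∈ Finset.Icc 1 (k + 1), p j := by
  induction k with
  | zero => simpa using one_sub_sum_largest_le hp hanti hsum hk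
  | succ k ih =>
    have h := ih (by omega)
    have hpr : 0 ≤ ∏ j ∈ Finset.Icc 1 k, (1 - ∑ l ∈ Finset.Icc 1 j, p l) :=
      Finset.prod_nonneg fun j hj => by
        rw [Finset.mem_Icc] at hj
        exact (one_sub_sum_largest_pos hp hsum (by omega)).le
    rw [Finset.prod_Icc_succ_top (by omega), Finset.prod_Icc_succ_top (by omega)]
    refine (mul_le_mul h (one_sub_sum_largest_le hp hanti hsum hk)
      (one_sub_sum_largest_pos hp hsum hk).le (hpr.trans h)).trans_eq ?_
    ring

theorem natCast_mul_le_one (hn : 1 ≤ n) (hanti : AntitoneOn p (Set.Icc 1 n))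
    (hsum : ∑ i ∈ Finset.Icc 1 n, p i = 1) : n * p n ≤ 1 := by
  have h := Finset.card_nsmul_le_sum (Finset.Icc 1 n) p (p n) fun i hi => by
    rw [Finset.mem_Icc] at hi
    exact hanti hi ⟨hn, le_rfl⟩ hi.2
  simpa [hsum] using h

theorem log_two_div_le_lruMixingBound {m : ℕ} (hm : 1 ≤ m) (hmn : m < n)
    (hp : ∀ i ∈ Finset.Icc 1 n, 0 < p i) (hanti : AntitoneOn p (Set.Icc 1 n))
    (hsum : ∑ i ∈ Finset.Icc 1 n, p i = 1) :
    Real.log 2 / p n ^ 4 ≤ lruMixingBound n m p := by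
  obtain ⟨k, rfl⟩ : ∃ k, m = k + 1 := ⟨m - 1, by omega⟩
  have hpn : 0 < p n := hp n (Finset.mem_Icc.2 ⟨by omega, le_rfl⟩)
  have hA := prod_smallest_le hp hsum (k := k) (by omega)
  have hB := prod_one_sub_sum_largest_le hp hanti hsum (k := k) (by omega)
  have hL : 0 < ∏ j ∈ Finset.Icc (n - k) n, p j := Finset.prod_pos fun j hj => by
    rw [Finset.mem_Icc] at hj
    exact hp j (Finset.mem_Icc.2 ⟨by omega, hj.2⟩)
  have hD : 0 < ∏ j ∈ Finset.Icc 1 k, (1 - ∑ l ∈ Finset.Icc 1 j, p l) :=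
    Finset.prod_pos fun j hj => by
      rw [Finset.mem_Icc] at hj
      exact one_sub_sum_largest_pos hp hsum (by omega)
  have hn2 : 2 * p n ≤ 1 := by
    refine le_trans ?_ (natCast_mul_le_one (by omega) hanti hsum)
    exact mul_le_mul_of_nonneg_right (by exact_mod_cast (by omega : 2 ≤ n)) hpn.le
  unfold lruMixingBound
  rw [Nat.add_sub_cancel, show n - (k + 1) + 1 = n - k by omega, Finset.prod_pow,
    Finset.prod_pow]
  generalize ∏ j ∈ Finset.Icc 1 k, (1 - ∑ l ∈ Finset.Icc 1 j, p (n - l + 1)) = R at *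
  generalize ∏ j ∈ Finset.Icc (n - k) n, p j = L at *
  generalize ∏ j ∈ Finset.Icc 1 k, (1 - ∑ l ∈ Finset.Icc 1 j, p l) = D at *
  generalize ∏ j ∈ Finset.Icc 1 (k + 1), p j = U at *
  have hRL : 1 / p n ≤ R / L := by
    rw [div_le_div_iff₀ hpn hL]
    linarith
  -- Here `n ≥ 2` enters; it keeps the logarithm at least `log 2`.
  have h2 : 2 ≤ 1 / p n := by
    rw [le_div_iff₀ hpn]
    exact hn2
  have hUD : 1 ≤ (n : ℝ) ^ (k + 1) * U / D := (one_le_div hD).2 hB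
  -- The fourth power is at least 1 and `(R / L) ^ 2` at least `(1 / p n) ^ 2`, which leaves `(1 / p
  -- n) ^ 4`.
  have hsplit : (n : ℝ) ^ (4 * (k + 1)) * U ^ 4 * R ^ 2 / (p n ^ 2 * D ^ 4 * L ^ 2)
      = ((n : ℝ) ^ (k + 1) * U / D) ^ 4 * ((R / L) ^ 2 * (1 / p n) ^ 2) := by
    rw [mul_comm 4, pow_mul]
    field_simp
  rw [hsplit]
  have hfirst : (1 / p n) ^ 4
      ≤ ((n : ℝ) ^ (k + 1) * U / D) ^ 4 * ((R / L) ^ 2 * (1 / p n) ^ 2) := by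
    calc (1 / p n) ^ 4 = 1 * ((1 / p n) ^ 2 * (1 / p n) ^ 2) := by ring
      _ ≤ _ := by
        gcongr
        exact one_le_pow₀ hUD
  have hlog : Real.log 2 ≤ Real.log (R / L) := Real.log_le_log two_pos (h2.trans hRL)
  have hlog2 : 0 ≤ Real.log 2 := Real.log_nonneg one_le_two
  calc Real.log 2 / p n ^ 4 = (1 / p n) ^ 4 * Real.log 2 := by field_simp
    _ ≤ _ := mul_le_mul hfirst hlog hlog2 ((by positivity : 0 ≤ (1 / p n) ^ 4).trans hfirst)

end Bound

/-! ### Mixing time and conclusion. -/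

theorem mul_one_sub_div_pow_le_half {m q : ℝ} (hm : 1 ≤ m) (hq0 : 0 < q) (hq1 : q ≤ 1) {t : ℕ}
    (ht : 2 * m ^ 2 / q ≤ t) : m * (1 - q / m) ^ t ≤ 1 / 2 := by
  have hr0 : 0 ≤ 1 - q / m := by
    rw [sub_nonneg, div_le_one (by linarith)]
    linarith
  have h1 : (1 - q / m) ^ t ≤ Real.exp (-(2 * m)) := by
    calc (1 - q / m) ^ t ≤ Real.exp (-(q / m)) ^ t :=
          pow_le_pow_left₀ hr0 (Real.one_sub_le_exp_neg _) t
      _ = Real.exp (t * -(q / m)) := (Real.exp_nat_mul _ t).symm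
      _ ≤ _ := by
        refine Real.exp_le_exp.2 ?_
        have h := mul_le_mul_of_nonneg_right ht (by positivity : 0 ≤ q / m)
        have e : 2 * m ^ 2 / q * (q / m) = 2 * m := by
          field_simp
        linarith
  have h2 : 2 * m * Real.exp (-(2 * m)) ≤ 1 := by
    rw [Real.exp_neg, ← div_eq_mul_inv, div_le_one (Real.exp_pos _)]
    linarith [Real.add_one_le_exp (2 * m)]
  nlinarith [mul_le_mul_of_nonneg_left h1 (by linarith : 0 ≤ m)]

theorem mainTheorem5 :
    ∃ C : ℝ, 0 < C ∧
      ∀ (n m : ℕ) (p : ℕ → ℝ), 1 ≤ m → m < n →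
        (∀ i ∈ Finset.Icc 1 n, 0 < p i) →
        AntitoneOn p (Set.Icc 1 n) →
        ∑ i ∈ Finset.Icc 1 n, p i = 1 →
        ∃ π : CacheState n m → ℝ,
          IsStationaryDist (lruMatrix n m p) π ∧
          (∀ π' : CacheState n m → ℝ, IsStationaryDist (lruMatrix n m p) π' → π' = π) ∧
          ∃ t : ℕ, IsMixingTime (lruMatrix n m p) π (1 / 2) t ∧
            (t : ℝ) ≤ C * lruMixingBound n m p := by
  have hlog2 : 0 < Real.log 2 := Real.log_pos one_lt_two
  -- The 3 is the 2 of `2 * m ^ 2 / p n` plus 1 for rounding up; `log 2` cancels the one in the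
  -- lower bound.
  refine ⟨3 / Real.log 2, by positivity, fun n m p hm hmn hp hanti hsum => ?_⟩
  have hpn : 0 < p n := hp n (Finset.mem_Icc.2 ⟨by omega, le_rfl⟩)
  have hnp := natCast_mul_le_one (by omega) hanti hsum
  have hm1 : (1 : ℝ) ≤ m := by exact_mod_cast hm
  have hmn' : (m : ℝ) ≤ n := by exact_mod_cast hmn.le
  have hpn1 : p n ≤ 1 := by nlinarith
  have hr0 : 0 ≤ 1 - p n / m := by
    rw [sub_nonneg, div_le_one (by linarith)]
    linarith
  have hr1 : 1 - p n / m < 1 := by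
    have : 0 < p n / m := by positivity
    linarith
  have hdecay : ∀ t (x z : CacheState n m),
      tvDist ((lruMatrix n m p ^ t) x) ((lruMatrix n m p ^ t) z) ≤ m * (1 - p n / m) ^ t :=
    fun t x z => by
      -- With `k = 0` the prefixes are empty, so the states are arbitrary.
      simpa using tvDist_lruMatrix_pow_le hm hmn hp hanti hsum hpn1 t 0 (Nat.zero_le m) x z rfl
  have := nonempty_cacheState hmn
  obtain ⟨π, hπ, huniq⟩ := existsUnique_isStationaryDist
    (lruMatrix_mem_stdSimplex hp hsum) hr0 hr1 hdecay
  refine ⟨π, hπ, huniq, ?_⟩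
  have hmem : ⌈2 * (m : ℝ) ^ 2 / p n⌉₊ ∈ {s : ℕ | ∀ x : CacheState n m,
      tvDist ((lruMatrix n m p ^ s) x) π ≤ 1 / 2} := fun x =>
    (hπ.tvDist_pow_le (hdecay _) x).trans
      (mul_one_sub_div_pow_le_half hm1 hpn hpn1 (Nat.le_ceil _))
  refine ⟨sInf _, ⟨Nat.sInf_mem ⟨_, hmem⟩, fun s hs => Nat.sInf_le hs⟩, ?_⟩
  have hle : (⌈2 * (m : ℝ) ^ 2 / p n⌉₊ : ℝ) ≤ 3 / p n ^ 4 := by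
    refine (Nat.ceil_lt_add_one (by positivity)).le.trans ?_
    rw [div_add_one hpn.ne', div_le_div_iff₀ hpn (by positivity)]
    have hmp : m * p n ≤ 1 := (mul_le_mul_of_nonneg_right hmn' hpn.le).trans hnp
    have h1 : (m * p n) ^ 2 ≤ 1 := pow_le_one₀ (by positivity) hmp
    have h2 : p n ^ 3 ≤ 1 := pow_le_one₀ hpn.le hpn1
    have h3 : 2 * (m * p n) ^ 2 * p n + p n ^ 3 * p n ≤ 3 := by nlinarith [pow_pos hpn 3]
    calc (2 * (m : ℝ) ^ 2 + p n) * p n ^ 4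
        = (2 * (m * p n) ^ 2 * p n + p n ^ 3 * p n) * p n := by ring
      _ ≤ 3 * p n := mul_le_mul_of_nonneg_right h3 hpn.le
  have hbound := log_two_div_le_lruMixingBound hm hmn hp hanti hsum
  calc _ ≤ (⌈2 * (m : ℝ) ^ 2 / p n⌉₊ : ℝ) := by exact_mod_cast Nat.sInf_le hmem
    _ ≤ 3 / p n ^ 4 := hle
    _ = 3 / Real.log 2 * (Real.log 2 / p n ^ 4) := by field_simp
    _ ≤ _ := mul_le_mul_of_nonneg_left hbound (by positivity)
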